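/- Let $(\Omega,\Sigma,\mu)$ be a nonatomic probability space, let $L_1=L_1(\Omega,\Sigma,\mu)$ be the real Banach space of (classes of) integrable functions, and let $X$ be a real Banach space. For a linear subspace $\mathcal U$ of the space $\mathcal L(L_1,X)$ of bounded linear operators, let $\mathrm{unc}(\mathcal U)$ be the set of all $S\in\mathcal L(L_1,X)$ for which there are $T_1,T_2,\dots\in\mathcal U$ such that, for every $f\in L_1$, the series $\sum_{k=1}^\infty T_kf$ converges unconditionally in $X$ to $Sf$; this is again a linear subspace of $\mathcal L(L_1,X)$. Let $\mathcal U_0=\mathcal K(L_1,X)$ be the space of compact operators and $\mathcal U_{n+1}=\mathrm{unc}(\mathcal U_n)$ for $n\ge 0$. Then for every $n\ge 0$ no isomorphic embedding lies in $\mathcal U_n=\mathrm{unc}(\dots(\mathrm{unc}(\mathcal K(L_1,X))))$; that is, no $J\in\mathcal U_n$ satisfies $\|Jf\|\ge c\|f\|$ for all $f\in L_1$ with some constant $c>0$. -/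

import Mathlib

open MeasureTheory

/-- A measure is nonatomic if every measurable set of positive measure contains a measurable
subset of strictly smaller positive measure. (Mathlib's `NoAtoms` only says that points are
null sets.) -/
def IsNonatomic {Ω : Type*} [MeasurableSpace Ω] (μ : Measure Ω) : Prop :=
  ∀ A : Set Ω, MeasurableSet A → 0 < μ A →
    ∃ B : Set Ω, MeasurableSet B ∧ B ⊆ A ∧ 0 < μ B ∧ μ B < μ A

section Operators

variable {E X : Type*} [NormedAddCommGroup E] [NormedSpace ℝ E]
  [NormedAddCommGroup X] [NormedSpace ℝ X]

/-- The series `∑ T n` of operators converges pointwise unconditionally to the operator `S`: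
for every `x` the series `∑ T n x` converges unconditionally to `S x` in norm
(`HasSum` is the limit along the net of all finite sets of indices). -/
def PointwiseUncondSum (T : ℕ → E →L[ℝ] X) (S : E →L[ℝ] X) : Prop :=
  ∀ x : E, HasSum (fun n => T n x) (S x)

/-- `unc U`: all operators that can be represented by pointwise unconditionally convergent
series of operators from the linear subspace `U`; it is again a linear subspace. -/
def unc (U : Submodule ℝ (E →L[ℝ] X)) : Submodule ℝ (E →L[ℝ] X) where
  carrier := { S | ∃ T : ℕ → E →L[ℝ] X, (∀ n, T n ∈ U) ∧ PointwiseUncondSum T S }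
  zero_mem' := ⟨fun _ => 0, fun _ => U.zero_mem, fun _ => by simp⟩
  add_mem' := by
    rintro S S' ⟨T, hT, hS⟩ ⟨T', hT', hS'⟩
    exact ⟨fun n => T n + T' n, fun n => U.add_mem (hT n) (hT' n),
      fun x => by simpa using (hS x).add (hS' x)⟩
  smul_mem' := by
    rintro c S ⟨T, hT, hS⟩
    exact ⟨fun n => c • T n, fun n => U.smul_mem c (hT n),
      fun x => by simpa using (hS x).const_smul c⟩

/-- `uncIter E X n` is `unc (… (unc (K(E, X))))` with `n` applications of `unc`, where
`K(E, X)` is the space of compact operators. -/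
def uncIter (E X : Type*) [NormedAddCommGroup E] [NormedSpace ℝ E]
    [NormedAddCommGroup X] [NormedSpace ℝ X] : ℕ → Submodule ℝ (E →L[ℝ] X)
  | 0 => compactOperator (RingHom.id ℝ) E X
  | n + 1 => unc (uncIter E X n)

/-- `J` is an isomorphic embedding (an isomorphism onto its image): it is bounded from below. -/
def IsIsomorphicEmbedding (J : E →L[ℝ] X) : Prop :=
  ∃ c : ℝ, 0 < c ∧ ∀ x : E, c * ‖x‖ ≤ ‖J x‖

end Operators

/-! The proof runs through narrowness: `T` is narrow if every set of positive measure carries a mean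
zero sign with small image. An embedding is not narrow, since signs on the whole space have norm
`μ(Ω) > 0`. Compact operators are narrow, by a pairing argument. The heart is
`PointwiseUncondSum.isNarrow`: a pointwise unconditional sum `S` of jointly narrow operators is
narrow. Joint narrowness comes from the induction hypothesis applied to the tuple `(T₀, …, T_{N-1})`
with values in `X^N`.

For the sum, sets are halved repeatedly by signs, with a walk moving `+1` on one half and `-1` on
the other until it reaches `±m`. Along a path, the normalized signs `g_j` are chosen with disjoint
blocks `W_j` of the series so that `W_j g_j ≈ S g_j` and `W_j g_i ≈ 0` for `i ≠ j`. Hence `∑ S g_j ≈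
(∑ ±W_j)(∑ ±g_j)`. The first factor is bounded by unconditionality; the second is a difference of
two normalized indicators. So the image under `S` of the stopped walk, essentially `m` times a sign,
is bounded independently of `m`. -/

section Sierpinski

open Filter Topology

variable {Ω : Type*} [MeasurableSpace Ω] {μ : Measure Ω}

/-- In a nonempty bounded family one can go at least half of the way towards the supremum. -/
theorem exists_superset_half_gain {A B : Set Ω} {t : ℝ} (hB : MeasurableSet B) (hBA : B ⊆ A)
    (hBt : μ.real B ≤ t) :
    ∃ B', MeasurableSet B' ∧ B' ⊆ A ∧ μ.real B' ≤ t ∧ B ⊆ B' ∧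
      ∀ D, MeasurableSet D → D ⊆ A → μ.real D ≤ t → B ⊆ D →
        μ.real D - μ.real B ≤ 2 * (μ.real B' - μ.real B) := by
  let S : Set ℝ := {r | ∃ D, MeasurableSet D ∧ D ⊆ A ∧ μ.real D ≤ t ∧ B ⊆ D ∧
    μ.real D - μ.real B = r}
  have hbdd : BddAbove S := by
    refine ⟨t - μ.real B, ?_⟩
    rintro r ⟨D, -, -, hD, -, rfl⟩
    linarith
  have h0 : (0 : ℝ) ∈ S := ⟨B, hB, hBA, hBt, subset_rfl, sub_self _⟩
  rcases (le_csSup hbdd h0).eq_or_lt with h | h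
  · refine ⟨B, hB, hBA, hBt, subset_rfl, fun D h1 h2 h3 h4 => ?_⟩
    have := le_csSup hbdd ⟨D, h1, h2, h3, h4, rfl⟩
    linarith
  · obtain ⟨r, ⟨B', h1, h2, h3, h4, rfl⟩, hr⟩ := exists_lt_of_lt_csSup ⟨0, h0⟩ (half_lt_self h)
    refine ⟨B', h1, h2, h3, h4, fun D g1 g2 g3 g4 => ?_⟩
    have := le_csSup hbdd ⟨D, g1, g2, g3, g4, rfl⟩
    linarith

variable [IsFiniteMeasure μ]

theorem IsNonatomic.exists_subset_le_half (hμ : IsNonatomic μ) {A : Set Ω} (hA : MeasurableSet A)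
    (hpos : 0 < μ.real A) :
    ∃ B ⊆ A, MeasurableSet B ∧ 0 < μ.real B ∧ μ.real B ≤ μ.real A / 2 := by
  obtain ⟨B, hB, hBA, h0, h1⟩ := hμ A hA (by simpa [measureReal_def, ENNReal.toReal_pos_iff] using hpos)
  have h0' : 0 < μ.real B := ENNReal.toReal_pos h0.ne' (measure_ne_top _ _)
  have h1' : μ.real B < μ.real A := ENNReal.toReal_strict_mono (measure_ne_top _ _) h1
  have hd : μ.real (A \ B) = μ.real A - μ.real B := measureReal_sdiff hBA hB
  rcases le_total (μ.real B) (μ.real A / 2) with h | h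
  · exact ⟨B, hBA, hB, h0', h⟩
  · exact ⟨A \ B, Set.sdiff_subset, hA.diff hB, by linarith, by linarith⟩

theorem IsNonatomic.exists_subset_lt (hμ : IsNonatomic μ) {A : Set Ω} (hA : MeasurableSet A)
    (hpos : 0 < μ.real A) {ε : ℝ} (hε : 0 < ε) :
    ∃ B ⊆ A, MeasurableSet B ∧ 0 < μ.real B ∧ μ.real B < ε := by
  have key : ∀ n : ℕ, ∃ B ⊆ A, MeasurableSet B ∧ 0 < μ.real B ∧
      μ.real B ≤ μ.real A * (1 / 2) ^ n := by
    intro n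
    induction n with
    | zero => exact ⟨A, subset_rfl, hA, hpos, by simp⟩
    | succ n ih =>
      obtain ⟨B, hBA, hB, h0, h1⟩ := ih
      obtain ⟨C, hCB, hC, h2, h3⟩ := hμ.exists_subset_le_half hB h0
      exact ⟨C, hCB.trans hBA, hC, h2, by rw [pow_succ]; linarith⟩
  obtain ⟨n, hn⟩ := exists_pow_lt_of_lt_one (div_pos hε hpos) (by norm_num : (1 / 2 : ℝ) < 1)
  obtain ⟨B, hBA, hB, h0, h1⟩ := key n
  refine ⟨B, hBA, hB, h0, h1.trans_lt ?_⟩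
  rw [lt_div_iff₀ hpos] at hn
  linarith

/-- Sierpiński's theorem: a finite nonatomic measure takes all intermediate values. -/
theorem IsNonatomic.exists_subset_eq (hμ : IsNonatomic μ) {A : Set Ω} (hA : MeasurableSet A)
    {t : ℝ} (ht0 : 0 ≤ t) (htA : t ≤ μ.real A) :
    ∃ B ⊆ A, MeasurableSet B ∧ μ.real B = t := by
  let G := {B : Set Ω // MeasurableSet B ∧ B ⊆ A ∧ μ.real B ≤ t}
  have hstep : ∀ B : G, ∃ B' : G, B.1 ⊆ B'.1 ∧
      ∀ D, MeasurableSet D → D ⊆ A → μ.real D ≤ t → B.1 ⊆ D →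
        μ.real D - μ.real B.1 ≤ 2 * (μ.real B'.1 - μ.real B.1) := by
    rintro ⟨B, h1, h2, h3⟩
    obtain ⟨B', g1, g2, g3, g4, g5⟩ := exists_superset_half_gain h1 h2 h3
    exact ⟨⟨B', g1, g2, g3⟩, g4, g5⟩
  choose next hsub hgain using hstep
  let u : ℕ → G := fun n => Nat.rec ⟨∅, .empty, Set.empty_subset _, by simpa using ht0⟩
    (fun _ B => next B) n
  have hmono : Monotone fun n => (u n).1 := monotone_nat_of_le_succ fun n => hsub (u n)
  have hmeas : MeasurableSet (⋃ n, (u n).1) := .iUnion fun n => (u n).2.1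
  have hsubA : ⋃ n, (u n).1 ⊆ A := Set.iUnion_subset fun n => (u n).2.2.1
  have hlim : Tendsto (fun n => μ.real (u n).1) atTop (𝓝 (μ.real (⋃ n, (u n).1))) :=
    (ENNReal.tendsto_toReal (measure_ne_top _ _)).comp (tendsto_measure_iUnion_atTop hmono)
  have hle : μ.real (⋃ n, (u n).1) ≤ t := le_of_tendsto' hlim fun n => (u n).2.2.2
  refine ⟨_, hsubA, hmeas, hle.eq_or_lt.resolve_right fun hlt => ?_⟩
  have hd : μ.real (A \ ⋃ n, (u n).1) = μ.real A - μ.real (⋃ n, (u n).1) :=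
    measureReal_sdiff hsubA hmeas
  obtain ⟨D, hDA, hD, hD0, hDt⟩ := hμ.exists_subset_lt (hA.diff hmeas) (by linarith)
    (sub_pos.2 hlt)
  have hgainD : ∀ n, μ.real D ≤ 2 * (μ.real (u (n + 1)).1 - μ.real (u n).1) := by
    intro n
    have hdisj : Disjoint (u n).1 D :=
      (Set.disjoint_sdiff_right.mono_right hDA).mono_left (Set.subset_iUnion (fun n => (u n).1) n)
    have hun : μ.real ((u n).1 ∪ D) = μ.real (u n).1 + μ.real D := measureReal_union hdisj hD
    have hun_le : μ.real (u n).1 ≤ μ.real (⋃ n, (u n).1) :=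
      measureReal_mono (Set.subset_iUnion (fun n => (u n).1) n)
    have := hgain (u n) ((u n).1 ∪ D) ((u n).2.1.union hD)
      (Set.union_subset (u n).2.2.1 (hDA.trans Set.sdiff_subset)) (by linarith)
      Set.subset_union_left
    have h2 : u (n + 1) = next (u n) := rfl
    rw [h2]
    linarith
  have hlim0 : Tendsto (fun n => 2 * (μ.real (u (n + 1)).1 - μ.real (u n).1)) atTop (𝓝 0) := by
    simpa using ((hlim.comp (tendsto_add_atTop_nat 1)).sub hlim).const_mul 2
  exact absurd (ge_of_tendsto' hlim0 hgainD) (not_le.2 hD0)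

end Sierpinski

/-! ### Indicators and signs in `L₁`. -/

section Indicator

variable {Ω : Type*} [MeasurableSpace Ω] (μ : Measure Ω) [IsFiniteMeasure μ]

open Classical in
/-- The indicator function of a measurable set as an element of `L₁`
(zero for non-measurable sets). -/
noncomputable def indL1 (A : Set Ω) : Lp ℝ 1 μ :=
  if hA : MeasurableSet A then indicatorConstLp 1 hA (measure_ne_top μ A) (1 : ℝ) else 0

variable {μ}

theorem norm_indL1 {A : Set Ω} (hA : MeasurableSet A) : ‖indL1 μ A‖ = μ.real A := by
  simp [indL1, hA, norm_indicatorConstLp]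

theorem indL1_union {A B : Set Ω} (hA : MeasurableSet A) (hB : MeasurableSet B)
    (h : Disjoint A B) : indL1 μ (A ∪ B) = indL1 μ A + indL1 μ B := by
  simp only [indL1, hA, hB, hA.union hB, dif_pos]
  exact indicatorConstLp_disjoint_union hA hB (measure_ne_top _ _) (measure_ne_top _ _) h 1

@[simp] theorem indL1_empty : indL1 μ (∅ : Set Ω) = 0 := by
  simp [indL1]

theorem indL1_diff {A B : Set Ω} (hA : MeasurableSet A) (hB : MeasurableSet B) (h : B ⊆ A) :
    indL1 μ (A \ B) = indL1 μ A - indL1 μ B := by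
  rw [eq_sub_iff_add_eq, ← indL1_union (hA.diff hB) hB Set.disjoint_sdiff_left,
    Set.sdiff_union_of_subset h]

theorem norm_two_smul_indL1_sub {A B : Set Ω} (hA : MeasurableSet A) (hB : MeasurableSet B)
    (h : B ⊆ A) : ‖(2 : ℝ) • indL1 μ B - indL1 μ A‖ = μ.real A := by
  rw [← norm_indL1 hA, Lp.norm_def, Lp.norm_def]
  congr 1
  apply eLpNorm_congr_norm_ae
  have e1 : indL1 μ A =ᵐ[μ] A.indicator fun _ => (1 : ℝ) := by
    simp only [indL1, hA, dif_pos]; exact indicatorConstLp_coeFn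
  have e2 : indL1 μ B =ᵐ[μ] B.indicator fun _ => (1 : ℝ) := by
    simp only [indL1, hB, dif_pos]; exact indicatorConstLp_coeFn
  filter_upwards [e1, e2, Lp.coeFn_sub ((2 : ℝ) • indL1 μ B) (indL1 μ A),
    Lp.coeFn_smul (2 : ℝ) (indL1 μ B)] with x h1 h2 h3 h4
  rw [h3, Pi.sub_apply, h4, Pi.smul_apply, h1, h2]
  by_cases hxB : x ∈ B
  · norm_num [hxB, h hxB]
  · by_cases hxA : x ∈ A <;> simp [hxA, hxB]

end Indicator

/-! ### Narrow operators; compact operators are narrow. -/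

section Narrow

variable {Ω : Type*} [MeasurableSpace Ω] {μ : Measure Ω} [IsFiniteMeasure μ]
  {X : Type*} [NormedAddCommGroup X] [NormedSpace ℝ X]

/-- An operator on `L₁` is narrow if every set of positive measure carries a mean zero sign
`1_P - 1_{A \ P} = 2 · 1_P - 1_A` with small image. -/
def IsNarrow (T : Lp ℝ 1 μ →L[ℝ] X) : Prop :=
  ∀ A : Set Ω, MeasurableSet A → 0 < μ.real A → ∀ ε : ℝ, 0 < ε →
    ∃ P ⊆ A, MeasurableSet P ∧ μ.real P = μ.real A / 2 ∧
      ‖T ((2 : ℝ) • indL1 μ P - indL1 μ A)‖ < ε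

theorem IsNarrow.not_isIsomorphicEmbedding [NeZero μ] {T : Lp ℝ 1 μ →L[ℝ] X} (hT : IsNarrow T) :
    ¬ IsIsomorphicEmbedding T := by
  rintro ⟨c, hc, h⟩
  have hpos : 0 < μ.real Set.univ := measureReal_univ_pos
  obtain ⟨P, hPA, hP, -, hlt⟩ := hT Set.univ .univ hpos _ (mul_pos hc hpos)
  have := h ((2 : ℝ) • indL1 μ P - indL1 μ Set.univ)
  rw [norm_two_smul_indL1_sub .univ hP hPA] at this
  linarith

/-- Pairing nearby vectors with opposite signs: a family taken from a totally bounded set has a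
signed sum which is small compared with the number of its members. -/
theorem exists_signs_norm_sum_le {K : Set X} (hK : TotallyBounded K) {R ε : ℝ}
    (hR0 : 0 ≤ R) (hR : ∀ x ∈ K, ‖x‖ ≤ R) (hε : 0 < ε) :
    ∃ q : ℕ, ∀ (s : Finset ℕ) (x : ℕ → X), (∀ i ∈ s, x i ∈ K) →
      ∃ θ : ℕ → ℝ, (∀ i, θ i = 1 ∨ θ i = -1) ∧ ‖∑ i ∈ s, θ i • x i‖ ≤ ε * s.card + q * R := by
  obtain ⟨t, htfin, ht⟩ := Metric.totallyBounded_iff.1 hK ε hε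
  refine ⟨htfin.toFinset.card, fun s => ?_⟩
  induction s using Finset.strongInduction with
  | H s ih =>
  intro x hx
  rcases le_or_gt s.card htfin.toFinset.card with hcard | hcard
  · refine ⟨fun _ => 1, fun _ => Or.inl rfl, ?_⟩
    calc ‖∑ i ∈ s, (1 : ℝ) • x i‖ ≤ ∑ i ∈ s, R :=
          norm_sum_le_of_le _ fun i hi => by simpa using hR _ (hx i hi)
      _ = s.card * R := by simp
      _ ≤ htfin.toFinset.card * R := by gcongr
      _ ≤ ε * s.card + htfin.toFinset.card * R := le_add_of_nonneg_left (by positivity)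
  -- Pigeonhole: two vectors in one ball get opposite signs, which costs at most `2 * ε` for two
  -- members.
  · have hc : ∀ i ∈ s, ∃ y ∈ htfin.toFinset, x i ∈ Metric.ball y ε := by
      intro i hi
      simpa using ht (hx i hi)
    choose! f hf1 hf2 using hc
    obtain ⟨i, hi, j, hj, hij, hfij⟩ := Finset.exists_ne_map_eq_of_card_lt_of_maps_to hcard hf1
    have hj' : j ∈ s.erase i := Finset.mem_erase.2 ⟨hij.symm, hj⟩
    obtain ⟨θ, hθ, hle⟩ := ih ((s.erase i).erase j)
      ((Finset.erase_ssubset hj').trans (Finset.erase_ssubset hi)) x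
      fun k hk => hx k (Finset.mem_of_mem_erase (Finset.mem_of_mem_erase hk))
    refine ⟨Function.update (Function.update θ i 1) j (-1), fun k => ?_, ?_⟩
    · rcases eq_or_ne k j with rfl | hkj
      · simp
      · rcases eq_or_ne k i with rfl | hki
        · simp [hkj]
        · simpa [hkj, hki] using hθ k
    · have hsum : ∑ k ∈ (s.erase i).erase j,
          Function.update (Function.update θ i 1) j (-1) k • x k =
          ∑ k ∈ (s.erase i).erase j, θ k • x k := by
        refine Finset.sum_congr rfl fun k hk => ?_
        simp only [Finset.mem_erase] at hk
        simp [hk.1, hk.2.1]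
      rw [← Finset.add_sum_erase _ _ hi, ← Finset.add_sum_erase _ _ hj', hsum]
      have hcard2 : (((s.erase i).erase j).card : ℝ) + 2 = s.card := by
        have h1 := Finset.card_erase_add_one hj'
        have h2 := Finset.card_erase_add_one hi
        exact_mod_cast (by omega : ((s.erase i).erase j).card + 2 = s.card)
      have hd : ‖x i - x j‖ ≤ 2 * ε := by
        rw [← dist_eq_norm]
        have h1 := Metric.mem_ball.1 (hf2 i hi)
        have h2 := Metric.mem_ball'.1 (hf2 j hj)
        rw [hfij] at h1
        linarith [dist_triangle (x i) (f j) (x j)]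
      simp only [Function.update_self, Function.update_of_ne hij, one_smul, neg_smul]
      rw [← add_assoc, ← sub_eq_add_neg]
      refine (norm_add_le _ _).trans ?_
      rw [← hcard2]
      linarith

/-- A set splits into `k` parts of equal measure, with mean zero signs `d i` on the parts, so that
each combination of the `d i` with coefficients `±1` is a mean zero sign. -/
theorem IsNonatomic.exists_signs (hμ : IsNonatomic μ) {ρ : ℝ} (hρ : 0 ≤ ρ) (k : ℕ) :
    ∀ A : Set Ω, MeasurableSet A → μ.real A = k * ρ →
    ∃ d : ℕ → Lp ℝ 1 μ, (∀ i < k, ‖d i‖ ≤ ρ) ∧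
      ∀ θ : ℕ → ℝ, (∀ i, θ i = 1 ∨ θ i = -1) → ∃ P ⊆ A, MeasurableSet P ∧
        μ.real P = μ.real A / 2 ∧
        ∑ i ∈ Finset.range k, θ i • d i = (2 : ℝ) • indL1 μ P - indL1 μ A := by
  induction k with
  | zero =>
    intro A hA hAρ
    refine ⟨0, by simp, fun θ _ => ⟨∅, Set.empty_subset _, .empty, by simp [hAρ], ?_⟩⟩
    have : indL1 μ A = 0 := by rw [← norm_eq_zero, norm_indL1 hA, hAρ]; simp
    simp [this]
  | succ k ih =>
    intro A hA hAρ
    push_cast at hAρ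
    obtain ⟨B, hBA, hB, hBρ⟩ := hμ.exists_subset_eq hA hρ (by nlinarith [k.cast_nonneg (α := ℝ)])
    obtain ⟨Q, hQB, hQ, hQρ⟩ := hμ.exists_subset_eq hB (t := ρ / 2) (by linarith) (by linarith)
    have hAB : μ.real (A \ B) = μ.real A - μ.real B := measureReal_sdiff hBA hB
    have hBQ : μ.real (B \ Q) = μ.real B - μ.real Q := measureReal_sdiff hQB hQ
    obtain ⟨d, hd, hsign⟩ := ih (A \ B) (hA.diff hB) (by linarith)
    refine ⟨Function.update d k ((2 : ℝ) • indL1 μ Q - indL1 μ B), fun i hi => ?_, fun θ hθ => ?_⟩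
    · rcases eq_or_ne i k with rfl | hik
      · simp [norm_two_smul_indL1_sub hB hQ hQB, hBρ]
      · simpa [hik] using hd i (by omega)
    · obtain ⟨P, hPA, hP, hPρ, hsum⟩ := hsign θ hθ
      have hsum' : ∑ i ∈ Finset.range (k + 1),
          θ i • Function.update d k ((2 : ℝ) • indL1 μ Q - indL1 μ B) i =
          (2 : ℝ) • indL1 μ P - indL1 μ (A \ B) + θ k • ((2 : ℝ) • indL1 μ Q - indL1 μ B) := by
        rw [Finset.sum_range_succ, ← hsum, Function.update_self]
        congr 1
        refine Finset.sum_congr rfl fun i hi => ?_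
        rw [Function.update_of_ne (Finset.mem_range.1 hi).ne]
      have hdisj : ∀ Q' ⊆ B, Disjoint P Q' := fun Q' h =>
        (Set.disjoint_sdiff_left (s := B) (t := A)).mono hPA h
      rw [hsum', indL1_diff hA hB hBA]
      rcases hθ k with h | h
      · refine ⟨P ∪ Q, Set.union_subset (hPA.trans Set.sdiff_subset) (hQB.trans hBA), hP.union hQ,
          ?_, ?_⟩
        · rw [measureReal_union (hdisj Q hQB) hQ]; linarith
        · rw [indL1_union hP hQ (hdisj Q hQB), h]; module
      -- Negating the sign on `B` exchanges `Q` with `B \ Q`.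
      · have hdQ := hdisj (B \ Q) Set.sdiff_subset
        refine ⟨P ∪ (B \ Q), Set.union_subset (hPA.trans Set.sdiff_subset)
          (Set.sdiff_subset.trans hBA), hP.union (hB.diff hQ), ?_, ?_⟩
        · rw [measureReal_union hdQ (hB.diff hQ)]; linarith
        · rw [indL1_union hP (hB.diff hQ) hdQ, indL1_diff hB hQ hQB, h]; module

/-- Signs on `k` equal parts, normalized, have images in one totally bounded set. Pairing leaves an
error `ε / 2` plus a term of order `1 / k`. -/
theorem IsNonatomic.isNarrow_of_isCompactOperator (hμ : IsNonatomic μ) {T : Lp ℝ 1 μ →L[ℝ] X}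
    (hT : IsCompactOperator T) : IsNarrow T := by
  intro A hA hpos ε hε
  have hK : TotallyBounded (T '' Metric.closedBall 0 1) :=
    (hT.isCompact_closure_image_closedBall 1).totallyBounded.subset subset_closure
  have hR : ∀ x ∈ T '' Metric.closedBall 0 1, ‖x‖ ≤ ‖T‖ := by
    rintro _ ⟨f, hf, rfl⟩
    exact T.unit_le_opNorm f (by simpa using hf)
  obtain ⟨q, hq⟩ := exists_signs_norm_sum_le hK (norm_nonneg T) hR (show 0 < ε / (2 * μ.real A) by positivity)
  obtain ⟨k, hk⟩ := exists_nat_gt (2 * μ.real A * q * ‖T‖ / ε)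
  have hk0 : (0 : ℝ) < k := lt_of_le_of_lt (by positivity) hk
  set ρ := μ.real A / k with hρ
  have hρ0 : 0 < ρ := by positivity
  have hkρ : μ.real A = k * ρ := by rw [hρ]; field_simp
  obtain ⟨d, hd, hsign⟩ := hμ.exists_signs hρ0.le k A hA hkρ
  obtain ⟨θ, hθ, hle⟩ := hq (Finset.range k) (fun i => T (ρ⁻¹ • d i)) fun i hi =>
    ⟨_, by
      rw [mem_closedBall_zero_iff, norm_smul, norm_inv, Real.norm_of_nonneg hρ0.le,
        inv_mul_le_one₀ hρ0]
      exact hd i (Finset.mem_range.1 hi), rfl⟩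
  obtain ⟨P, hPA, hP, hPm, hsum⟩ := hsign θ hθ
  refine ⟨P, hPA, hP, hPm, ?_⟩
  have hTsum : T ((2 : ℝ) • indL1 μ P - indL1 μ A) =
      ρ • ∑ i ∈ Finset.range k, θ i • T (ρ⁻¹ • d i) := by
    rw [← hsum, map_sum, Finset.smul_sum]
    refine Finset.sum_congr rfl fun i _ => ?_
    rw [map_smul, map_smul, smul_comm (θ i), smul_inv_smul₀ hρ0.ne']
  rw [hTsum, norm_smul, Real.norm_of_nonneg hρ0.le]
  rw [Finset.card_range] at hle
  calc _ ≤ ρ * (ε / (2 * μ.real A) * k + q * ‖T‖) := by gcongr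
    _ = ε / 2 + μ.real A * q * ‖T‖ / k := by rw [hρ]; field_simp
    _ < ε / 2 + ε / 2 := by
      rw [div_lt_iff₀ hε] at hk
      have : μ.real A * q * ‖T‖ / k < ε / 2 := by
        rw [div_lt_iff₀ hk0]
        linarith
      linarith
    _ = ε := add_halves ε

end Narrow

/-! ### Iterated `unc` and signed partial sums. -/

section Unc

variable {E X Y : Type*} [NormedAddCommGroup E] [NormedSpace ℝ E]
  [NormedAddCommGroup X] [NormedSpace ℝ X] [NormedAddCommGroup Y] [NormedSpace ℝ Y]

theorem uncIter_clm_comp (L : X →L[ℝ] Y) (n : ℕ) :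
    ∀ S ∈ uncIter E X n, L.comp S ∈ uncIter E Y n := by
  induction n with
  | zero => exact fun S hS => IsCompactOperator.clm_comp (f := S) hS L
  | succ n ih =>
    rintro S ⟨T, hT, hS⟩
    exact ⟨fun k => L.comp (T k), fun k => ih _ (hT k), fun x => (hS x).mapL L⟩

theorem uncIter_pi (n N : ℕ) (T : Fin N → E →L[ℝ] X) (hT : ∀ i, T i ∈ uncIter E X n) :
    ContinuousLinearMap.pi T ∈ uncIter E (Fin N → X) n := by
  have : ContinuousLinearMap.pi T =
      ∑ i, (ContinuousLinearMap.single ℝ (fun _ : Fin N => X) i).comp (T i) := by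
    ext x j
    simp [Finset.sum_apply, Pi.single_apply]
  rw [this]
  exact Submodule.sum_mem _ fun i _ => uncIter_clm_comp _ n _ (hT i)

/-- At each `x`, sums over sets containing a suitable `F₀` are bounded by convergence, and any other
sum differs from one of these by a subsum over `F₀`. Uniform boundedness does the rest. -/
theorem PointwiseUncondSum.exists_norm_sum_le [CompleteSpace E] {T : ℕ → E →L[ℝ] X}
    {S : E →L[ℝ] X} (hS : PointwiseUncondSum T S) :
    ∃ M : ℝ, ∀ F : Finset ℕ, ‖∑ n ∈ F, T n‖ ≤ M := by
  refine banach_steinhaus fun x => ?_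
  have hev : ∀ᶠ F in Filter.atTop, ‖∑ n ∈ F, T n x‖ < ‖S x‖ + 1 :=
    (hS x).norm.eventually_lt_const (lt_add_one _)
  obtain ⟨F₀, hF₀⟩ := Filter.eventually_atTop.1 hev
  refine ⟨‖S x‖ + 1 + ∑ n ∈ F₀, ‖T n x‖, fun F => ?_⟩
  rw [_root_.sum_apply]
  have hsplit : ∑ n ∈ F, T n x = ∑ n ∈ F₀ ∪ F, T n x - ∑ n ∈ F₀ \ F, T n x := by
    rw [eq_sub_iff_add_eq', ← Finset.sum_union Finset.sdiff_disjoint,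
      Finset.sdiff_union_self_eq_union]
  rw [hsplit]
  refine (norm_sub_le _ _).trans (add_le_add (hF₀ _ Finset.subset_union_left).le ?_)
  exact (norm_sum_le _ _).trans
    (Finset.sum_le_sum_of_subset_of_nonneg Finset.sdiff_subset fun _ _ _ => norm_nonneg _)

/-- The operators `∑ n ∈ F, T n - ∑ n ∈ G, T n` with `F` and `G` contained in `{0, …, N - 1}`. -/
def signedSums (T : ℕ → E →L[ℝ] X) (N : ℕ) : Set (E →L[ℝ] X) :=
  {V | ∃ F G : Finset ℕ, F ⊆ Finset.range N ∧ G ⊆ Finset.range N ∧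
    V = ∑ n ∈ F, T n - ∑ n ∈ G, T n}

variable {T : ℕ → E →L[ℝ] X} {N : ℕ} {V : E →L[ℝ] X}

theorem zero_mem_signedSums : (0 : E →L[ℝ] X) ∈ signedSums T N :=
  ⟨∅, ∅, by simp, by simp, by simp⟩

theorem neg_mem_signedSums (hV : V ∈ signedSums T N) : -V ∈ signedSums T N := by
  obtain ⟨F, G, hF, hG, rfl⟩ := hV
  exact ⟨G, F, hG, hF, by abel⟩

theorem add_sum_Ico_mem_signedSums (hV : V ∈ signedSums T N) {a b : ℕ} (hNa : N ≤ a)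
    (hab : a ≤ b) : V + ∑ n ∈ Finset.Ico a b, T n ∈ signedSums T b := by
  obtain ⟨F, G, hF, hG, rfl⟩ := hV
  have hNb : Finset.range N ⊆ Finset.range b := Finset.range_mono (hNa.trans hab)
  refine ⟨F ∪ Finset.Ico a b, G, Finset.union_subset (hF.trans hNb) fun i hi => ?_,
    hG.trans hNb, ?_⟩
  · exact Finset.mem_range.2 (Finset.mem_Ico.1 hi).2
  · rw [Finset.sum_union, add_sub_right_comm]
    refine Finset.disjoint_left.2 fun i hi hi' => ?_
    have h1 := Finset.mem_range.1 (hF hi)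
    have h2 := (Finset.mem_Ico.1 hi').1
    omega

theorem sub_sum_Ico_mem_signedSums (hV : V ∈ signedSums T N) {a b : ℕ} (hNa : N ≤ a)
    (hab : a ≤ b) : V - ∑ n ∈ Finset.Ico a b, T n ∈ signedSums T b := by
  simpa [neg_add_eq_sub] using
    neg_mem_signedSums (add_sum_Ico_mem_signedSums (neg_mem_signedSums hV) hNa hab)

theorem norm_le_of_mem_signedSums {M : ℝ} (hM : ∀ F : Finset ℕ, ‖∑ n ∈ F, T n‖ ≤ M)
    (hV : V ∈ signedSums T N) : ‖V‖ ≤ 2 * M := by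
  obtain ⟨F, G, -, -, rfl⟩ := hV
  linarith [norm_sub_le (∑ n ∈ F, T n) (∑ n ∈ G, T n), hM F, hM G]

theorem norm_apply_le_of_mem_signedSums {x : E} {η : ℝ} (hη : 0 ≤ η)
    (hx : ∀ n < N, ‖T n x‖ ≤ η) (hV : V ∈ signedSums T N) : ‖V x‖ ≤ 2 * (N * η) := by
  obtain ⟨F, G, hF, hG, rfl⟩ := hV
  have key : ∀ F ⊆ Finset.range N, ‖∑ n ∈ F, T n x‖ ≤ N * η := fun F hF =>
    calc ‖∑ n ∈ F, T n x‖ ≤ ∑ n ∈ F, η :=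
          norm_sum_le_of_le _ fun n hn => hx n (Finset.mem_range.1 (hF hn))
      _ = F.card * η := by simp
      _ ≤ N * η := by
          gcongr
          simpa using Finset.card_le_card hF
  simp only [_root_.sub_apply, _root_.sum_apply]
  linarith [norm_sub_le (∑ n ∈ F, T n x) (∑ n ∈ G, T n x), key F hF, key G hG]

end Unc

/-! ### Narrowness of unconditional sums via a stopped walk. -/

section NarrowSums

open Filter Topology

variable {Ω : Type*} [MeasurableSpace Ω] {μ : Measure Ω} [IsFiniteMeasure μ]
  {X : Type*} [NormedAddCommGroup X] [NormedSpace ℝ X]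
  {T : ℕ → Lp ℝ 1 μ →L[ℝ] X} {S : Lp ℝ 1 μ →L[ℝ] X}

/-- Any finitely many members of the sequence are simultaneously small on some mean zero sign
on each set of positive measure. -/
def JointlyNarrow (T : ℕ → Lp ℝ 1 μ →L[ℝ] X) : Prop :=
  ∀ N : ℕ, ∀ A : Set Ω, MeasurableSet A → 0 < μ.real A → ∀ ε : ℝ, 0 < ε →
    ∃ P ⊆ A, MeasurableSet P ∧ μ.real P = μ.real A / 2 ∧
      ∀ n < N, ‖T n ((2 : ℝ) • indL1 μ P - indL1 μ A)‖ < ε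

theorem JointlyNarrow.of_isNarrow_pi
    (h : ∀ N : ℕ, IsNarrow (ContinuousLinearMap.pi fun i : Fin N => T i)) : JointlyNarrow T := by
  intro N A hA hpos ε hε
  obtain ⟨P, hPA, hP, hPm, hlt⟩ := h N A hA hpos ε hε
  exact ⟨P, hPA, hP, hPm, fun n hn => (pi_norm_lt_iff hε).1 hlt ⟨n, hn⟩⟩

variable (μ) in
/-- The indicator function of `C`, normalized in `L₁`. -/
noncomputable def normIndL1 (C : Set Ω) : Lp ℝ 1 μ := (μ.real C)⁻¹ • indL1 μ C

theorem norm_normIndL1_le {C : Set Ω} (hC : MeasurableSet C) : ‖normIndL1 μ C‖ ≤ 1 := by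
  rw [normIndL1, norm_smul, norm_indL1 hC, norm_inv, Real.norm_of_nonneg measureReal_nonneg]
  exact inv_mul_le_one

/-- Normalized indicators along a path form a martingale with increments `±g`. -/
theorem normIndL1_half {B C : Set Ω} (hBm : μ.real B = μ.real C / 2) :
    normIndL1 μ B = normIndL1 μ C +
      (μ.real C)⁻¹ • ((2 : ℝ) • indL1 μ B - indL1 μ C) := by
  rw [normIndL1, normIndL1, hBm, inv_div, div_eq_mul_inv]
  module

theorem normIndL1_diff_half {B C : Set Ω} (hC : MeasurableSet C) (hB : MeasurableSet B)
    (hBC : B ⊆ C) (hBm : μ.real B = μ.real C / 2) :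
    normIndL1 μ (C \ B) = normIndL1 μ C -
      (μ.real C)⁻¹ • ((2 : ℝ) • indL1 μ B - indL1 μ C) := by
  rw [normIndL1, normIndL1, measureReal_sdiff hBC hB, hBm, indL1_diff hC hB hBC, sub_half, inv_div,
    div_eq_mul_inv]
  module

/-- One step of the walk: if `p` is close to `V (1_C / μ C - q)`, then `C` splits into two halves
on which `p + S h / μ C`, with `h` the corresponding sign, is again close to vectors of this
form. -/
theorem exists_half_close (hS : PointwiseUncondSum T S) (hT : JointlyNarrow T)
    (q : Lp ℝ 1 μ) {C : Set Ω} (hC : MeasurableSet C) (hpos : 0 < μ.real C) {p : X} {N : ℕ}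
    {V : Lp ℝ 1 μ →L[ℝ] X} (hV : V ∈ signedSums T N) (hp : ‖p - V (normIndL1 μ C - q)‖ < 1) :
    ∃ B ⊆ C, MeasurableSet B ∧ μ.real B = μ.real C / 2 ∧
      ∃ N', ∃ V₁ ∈ signedSums T N', ∃ V₀ ∈ signedSums T N',
        ‖p + (μ.real C)⁻¹ • S ((2 : ℝ) • indL1 μ B - indL1 μ C)
          - V₁ (normIndL1 μ B - q)‖ < 1 ∧
        ‖p + (μ.real C)⁻¹ • S ((2 : ℝ) • indL1 μ B - indL1 μ C)
          - V₀ (normIndL1 μ (C \ B) - q)‖ < 1 := by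
  set Q := normIndL1 μ C - q with hQ
  set δ := 1 - ‖p - V Q‖ with hδ
  have hδ0 : 0 < δ := by linarith
  have hpartial : ∀ x a, ∃ b ≥ a, ∀ k ≥ b, ‖∑ n ∈ Finset.range k, T n x - S x‖ < δ / 8 := by
    intro x a
    obtain ⟨b, hb⟩ := Metric.tendsto_atTop.1 (hS x).tendsto_sum_nat (δ / 8) (by positivity)
    exact ⟨max a b, le_max_left _ _, fun k hk => by
      simpa [dist_eq_norm] using hb k ((le_max_right _ _).trans hk)⟩
  -- The order matters: `N₁` makes later blocks small at `Q`, then `B` makes the first `N₁`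
  -- operators small at `g`, then `N₂` makes the block `W` reproduce `S g`. The three errors of `δ /
  -- 4` stay below the slack `δ`.
  obtain ⟨N₁, hN₁, htailQ⟩ := hpartial Q N
  set η := δ / (8 * (N₁ + 1)) with hη
  have hη0 : 0 < η := by positivity
  have hN₁η : N₁ * η ≤ δ / 8 := by
    rw [hη, mul_div_assoc', div_le_div_iff₀ (by positivity) (by positivity)]
    nlinarith
  obtain ⟨B, hBC, hB, hBm, hsmall⟩ := hT N₁ C hC hpos (μ.real C * η) (by positivity)
  set g := (μ.real C)⁻¹ • ((2 : ℝ) • indL1 μ B - indL1 μ C) with hg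
  have hgsmall : ∀ n < N₁, ‖T n g‖ ≤ η := by
    intro n hn
    rw [hg, map_smul, norm_smul, norm_inv, Real.norm_of_nonneg hpos.le, inv_mul_le_iff₀ hpos]
    exact (hsmall n hn).le
  obtain ⟨N₂, hN₂, htailg⟩ := hpartial g N₁
  set W := ∑ n ∈ Finset.Ico N₁ N₂, T n with hW
  have hWapply : ∀ x, W x = ∑ n ∈ Finset.range N₂, T n x - ∑ n ∈ Finset.range N₁, T n x := by
    intro x
    rw [hW, _root_.sum_apply, Finset.sum_Ico_eq_sub _ hN₂]
  have hVg : ‖V g‖ ≤ δ / 4 := by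
    have h1 := norm_apply_le_of_mem_signedSums hη0.le
      (fun n hn => hgsmall n (lt_of_lt_of_le hn hN₁)) hV
    have h2 : (N : ℝ) * η ≤ N₁ * η := by gcongr
    linarith
  have hWQ : ‖W Q‖ ≤ δ / 4 := by
    have h1 := htailQ N₂ hN₂
    have h2 := htailQ N₁ le_rfl
    rw [hWapply, ← sub_sub_sub_cancel_right _ _ (S Q)]
    linarith [norm_sub_le (∑ n ∈ Finset.range N₂, T n Q - S Q)
      (∑ n ∈ Finset.range N₁, T n Q - S Q)]
  have hWg : ‖S g - W g‖ ≤ δ / 4 := by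
    have h1 := htailg N₂ le_rfl
    have h2 : ‖∑ n ∈ Finset.range N₁, T n g‖ ≤ N₁ * η :=
      (norm_sum_le_of_le _ fun n hn => hgsmall n (Finset.mem_range.1 hn)).trans (by simp)
    have h3 : S g - W g = ∑ n ∈ Finset.range N₁, T n g
        - (∑ n ∈ Finset.range N₂, T n g - S g) := by
      rw [hWapply]; abel
    rw [h3]
    linarith [norm_sub_le (∑ n ∈ Finset.range N₁, T n g)
      (∑ n ∈ Finset.range N₂, T n g - S g)]
  have hSg : (μ.real C)⁻¹ • S ((2 : ℝ) • indL1 μ B - indL1 μ C) = S g := by rw [hg, map_smul]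
  -- The block takes the sign of the increment of the normalized indicator, so both halves
  -- contribute `W g ≈ S g`.
  refine ⟨B, hBC, hB, hBm, N₂, V + W, add_sum_Ico_mem_signedSums hV hN₁ hN₂, V - W,
    sub_sum_Ico_mem_signedSums hV hN₁ hN₂, ?_, ?_⟩
  · rw [hSg, normIndL1_half hBm, ← hg, add_sub_right_comm (normIndL1 μ C), ← hQ]
    have : p + S g - (V + W) (Q + g) = (p - V Q) - V g - W Q + (S g - W g) := by
      simp only [_root_.add_apply, map_add]; abel
    rw [this]
    calc _ ≤ ‖p - V Q‖ + ‖V g‖ + ‖W Q‖ + ‖S g - W g‖ :=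
          (norm_add_le _ _).trans (add_le_add_left ((norm_sub_le _ _).trans
            (add_le_add_left (norm_sub_le _ _) _)) _)
      _ < 1 := by linarith
  · rw [hSg, normIndL1_diff_half hC hB hBC hBm, ← hg, sub_right_comm (normIndL1 μ C), ← hQ]
    have : p + S g - (V - W) (Q - g) = (p - V Q) + V g + W Q + (S g - W g) := by
      simp only [_root_.sub_apply, map_sub]; abel
    rw [this]
    calc _ ≤ ‖p - V Q‖ + ‖V g‖ + ‖W Q‖ + ‖S g - W g‖ :=
          (norm_add_le _ _).trans (add_le_add_left ((norm_add_le _ _).trans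
            (add_le_add_left (norm_add_le _ _) _)) _)
      _ < 1 := by linarith

/-- A random walk on subsets of `C`, started at `x`, stopped at `±m` and run for at most `r`
steps: `c` is the measure of the set on which it has not been stopped, and the remainder `y`
replaces its values on this set by `±m`. -/
theorem exists_walk (hμ : IsNonatomic μ) (hS : PointwiseUncondSum T S) (hT : JointlyNarrow T)
    {M : ℝ} (hM : ∀ F : Finset ℕ, ‖∑ n ∈ F, T n‖ ≤ M) {q : Lp ℝ 1 μ} (hq : ‖q‖ ≤ 1)
    {m : ℕ} (hm : 0 < m) (r : ℕ) :
    ∀ (x : ℤ) (C : Set Ω) (p : X) (N : ℕ) (V : Lp ℝ 1 μ →L[ℝ] X), |x| ≤ m →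
      MeasurableSet C → 0 < μ.real C → V ∈ signedSums T N →
      ‖p - V (normIndL1 μ C - q)‖ < 1 →
      ∃ P ⊆ C, MeasurableSet P ∧ 2 * m * μ.real P = (m + x) * μ.real C ∧
        ∃ (c : ℝ) (y : Lp ℝ 1 μ), c ≤ μ.real C ∧ r * c ≤ (m ^ 2 - x ^ 2) * μ.real C ∧
          ‖y‖ ≤ 2 * m * c ∧
          ‖p + (μ.real C)⁻¹ • S ((m : ℝ) • ((2 : ℝ) • indL1 μ P - indL1 μ C) + y
            - (x : ℝ) • indL1 μ C)‖ ≤ 4 * M + 1 := by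
  have hm0 : (0 : ℝ) < m := by exact_mod_cast hm
  have hbound : ∀ (C : Set Ω) (p : X) (N : ℕ) (V : Lp ℝ 1 μ →L[ℝ] X), MeasurableSet C →
      V ∈ signedSums T N → ‖p - V (normIndL1 μ C - q)‖ < 1 → ‖p‖ ≤ 4 * M + 1 := by
    intro C p N V hC hV hp
    have h1 := norm_le_of_mem_signedSums hM hV
    have h2 : ‖normIndL1 μ C - q‖ ≤ 2 := by
      linarith [norm_sub_le (normIndL1 μ C) q, norm_normIndL1_le (μ := μ) hC]
    have h3 : ‖V (normIndL1 μ C - q)‖ ≤ 2 * M * 2 := V.le_of_opNorm_le_of_le h1 h2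
    have h4 := norm_le_norm_sub_add p (V (normIndL1 μ C - q))
    linarith
  have hstopped : ∀ (r : ℕ) (x : ℤ) (C : Set Ω) (p : X) (N : ℕ) (V : Lp ℝ 1 μ →L[ℝ] X),
      |x| = m → MeasurableSet C → V ∈ signedSums T N → ‖p - V (normIndL1 μ C - q)‖ < 1 →
      ∃ P ⊆ C, MeasurableSet P ∧ 2 * m * μ.real P = (m + x) * μ.real C ∧
        ∃ (c : ℝ) (y : Lp ℝ 1 μ), c ≤ μ.real C ∧ r * c ≤ (m ^ 2 - x ^ 2) * μ.real C ∧
          ‖y‖ ≤ 2 * m * c ∧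
          ‖p + (μ.real C)⁻¹ • S ((m : ℝ) • ((2 : ℝ) • indL1 μ P - indL1 μ C) + y
            - (x : ℝ) • indL1 μ C)‖ ≤ 4 * M + 1 := by
    intro r x C p N V hx hC hV hp
    have hb := hbound C p N V hC hV hp
    rcases eq_or_eq_neg_of_abs_eq hx with rfl | rfl
    · refine ⟨C, subset_rfl, hC, by push_cast; ring, 0, 0, measureReal_nonneg, by simp, by simp, ?_⟩
      have : (m : ℝ) • ((2 : ℝ) • indL1 μ C - indL1 μ C) + 0 - (((m : ℕ) : ℤ) : ℝ) • indL1 μ C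
          = 0 := by push_cast; module
      rw [this]; simpa using hb
    · refine ⟨∅, Set.empty_subset _, .empty, by simp, 0, 0, measureReal_nonneg, by simp, by simp,
        ?_⟩
      have : (m : ℝ) • ((2 : ℝ) • indL1 μ (∅ : Set Ω) - indL1 μ C) + 0
          - ((-((m : ℕ) : ℤ) : ℤ) : ℝ) • indL1 μ C = 0 := by
        rw [indL1_empty]; push_cast; module
      rw [this]; simpa using hb
  induction r with
  | zero =>
    intro x C p N V hx hC hpos hV hp
    have hxR : |(x : ℝ)| ≤ m := by exact_mod_cast hx
    obtain ⟨hx1, hx2⟩ := abs_le.1 hxR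
    obtain ⟨P, hPC, hP, hPm⟩ := hμ.exists_subset_eq hC
      (t := (m + x) * μ.real C / (2 * m)) (div_nonneg (mul_nonneg (by linarith) hpos.le)
        (by positivity)) (by
          rw [div_le_iff₀ (by positivity)]
          nlinarith)
    -- Out of steps: `P` gets the measure demanded by the mean of the walk, and `y` cancels the
    -- whole argument of `S`.
    refine ⟨P, hPC, hP, by rw [hPm]; field_simp, μ.real C,
      (x : ℝ) • indL1 μ C - (m : ℝ) • ((2 : ℝ) • indL1 μ P - indL1 μ C), le_rfl, ?_, ?_, ?_⟩
    · have : (0 : ℝ) ≤ m ^ 2 - x ^ 2 := by nlinarith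
      simpa using mul_nonneg this hpos.le
    · refine (norm_sub_le _ _).trans ?_
      rw [norm_smul, norm_smul, norm_indL1 hC, norm_two_smul_indL1_sub hC hP hPC,
        Real.norm_eq_abs, Real.norm_of_nonneg hm0.le]
      nlinarith
    · simpa using hbound C p N V hC hV hp
  | succ r ih =>
    intro x C p N V hx hC hpos hV hp
    rcases hx.eq_or_lt with hx | hx
    · exact hstopped (r + 1) x C p N V hx hC hV hp
    obtain ⟨B, hBC, hB, hBm, N', V₁, hV₁, V₀, hV₀, hp₁, hp₀⟩ :=
      exists_half_close hS hT q hC hpos hV hp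
    have hDm : μ.real (C \ B) = μ.real C / 2 := by rw [measureReal_sdiff hBC hB, hBm, sub_half]
    have hD := hC.diff hB
    obtain ⟨P₁, hP₁B, hP₁, hP₁m, c₁, y₁, hc₁, hrc₁, hy₁, hn₁⟩ :=
      ih (x + 1) B _ N' V₁ (by rw [abs_lt] at hx; rw [abs_le]; omega) hB (by linarith) hV₁ hp₁
    obtain ⟨P₀, hP₀D, hP₀, hP₀m, c₀, y₀, hc₀, hrc₀, hy₀, hn₀⟩ :=
      ih (x - 1) (C \ B) _ N' V₀ (by rw [abs_lt] at hx; rw [abs_le]; omega) hD (by linarith)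
        hV₀ hp₀
    have hdisj : Disjoint P₁ P₀ := Set.disjoint_sdiff_right.mono hP₁B hP₀D
    rw [hBm] at hP₁m hc₁ hrc₁ hn₁
    rw [hDm] at hP₀m hc₀ hrc₀ hn₀
    rw [indL1_diff hC hB hBC] at hn₀
    push_cast at hP₁m hP₀m hrc₁ hrc₀ hn₁ hn₀
    refine ⟨P₁ ∪ P₀, Set.union_subset (hP₁B.trans hBC) (hP₀D.trans Set.sdiff_subset),
      hP₁.union hP₀, ?_, c₁ + c₀, y₁ + y₀, by linarith, ?_, ?_, ?_⟩
    · rw [measureReal_union hdisj hP₀]; linarith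
    -- The mean of `m² - (x ± 1)²` is `m² - x² - 1`; the missing `1` pays for the extra step because
    -- `c₁ + c₀ ≤ μ.real C`.
    · push_cast; nlinarith
    · linarith [norm_add_le y₁ y₀]
    · rw [indL1_union hP₁ hP₀ hdisj]
      have key : ∀ u v : X, ‖u‖ ≤ 4 * M + 1 → ‖v‖ ≤ 4 * M + 1 →
          ‖(1 / 2 : ℝ) • u + (1 / 2 : ℝ) • v‖ ≤ 4 * M + 1 := by
        intro u v hu hv
        refine (norm_add_le _ _).trans ?_
        rw [norm_smul, norm_smul, Real.norm_of_nonneg (by norm_num : (0 : ℝ) ≤ 1 / 2)]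
        linarith
      convert key _ _ hn₁ hn₀ using 2
      have hinv : (μ.real C / 2)⁻¹ = 2 * (μ.real C)⁻¹ := by rw [inv_div, div_eq_mul_inv]
      rw [hinv]
      simp only [map_add, map_sub, map_smul]
      module

/-- The walk bounds `S (m • h + y)` independently of `m` and `r`. A large `m` makes this negligible
after division by `m`, and then a large `r` does the same for `S y`. -/
theorem PointwiseUncondSum.isNarrow (hμ : IsNonatomic μ) (hS : PointwiseUncondSum T S)
    (hT : JointlyNarrow T) : IsNarrow S := by
  intro A hA hpos ε hε
  obtain ⟨M, hM⟩ := hS.exists_norm_sum_le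
  have hM0 : 0 ≤ M := (norm_nonneg _).trans (hM ∅)
  obtain ⟨m, hm⟩ := exists_nat_gt (2 * ((4 * M + 1) * μ.real A) / ε)
  have hm0 : (0 : ℝ) < m := lt_of_le_of_lt (by positivity) hm
  obtain ⟨r, hr⟩ := exists_nat_gt (2 * (‖S‖ * (2 * m ^ 2 * μ.real A)) / ε)
  have hr0 : (0 : ℝ) < r := lt_of_le_of_lt (by positivity) hr
  obtain ⟨P, hPA, hP, hPm, c, y, -, hc, hy, hn⟩ :=
    exists_walk hμ hS hT hM (norm_normIndL1_le hA) (by exact_mod_cast hm0) r 0 A 0 0 0 (by simp)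
      hA hpos zero_mem_signedSums (by simp)
  refine ⟨P, hPA, hP, ?_, ?_⟩
  · have : (m : ℝ) * (2 * μ.real P - μ.real A) = 0 := by push_cast at hPm; linarith
    rcases mul_eq_zero.1 this with h | h <;> linarith
  set h := (2 : ℝ) • indL1 μ P - indL1 μ A with hh
  have hc' : c ≤ m ^ 2 * μ.real A / r := by
    rw [le_div_iff₀ hr0]; push_cast at hc; linarith
  have hn' : ‖S ((m : ℝ) • h + y)‖ ≤ (4 * M + 1) * μ.real A := by
    rw [zero_add, Int.cast_zero, zero_smul, sub_zero, norm_smul, norm_inv,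
      Real.norm_of_nonneg hpos.le, inv_mul_le_iff₀ hpos] at hn
    linarith
  have hSy : ‖S y‖ ≤ ‖S‖ * (2 * m * (m ^ 2 * μ.real A / r)) := by
    refine S.le_of_opNorm_le_of_le le_rfl (hy.trans ?_)
    gcongr
  have hmS : m * ‖S h‖ ≤ (4 * M + 1) * μ.real A + ‖S‖ * (2 * m * (m ^ 2 * μ.real A / r)) := by
    have : (m : ℝ) • S h = S ((m : ℝ) • h + y) - S y := by rw [map_add, map_smul]; abel
    rw [← Real.norm_of_nonneg hm0.le, ← norm_smul, this, Real.norm_of_nonneg hm0.le]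
    exact (norm_sub_le _ _).trans (add_le_add hn' hSy)
  rw [div_lt_iff₀ hε] at hm hr
  have hr' : ‖S‖ * (2 * m * (m ^ 2 * μ.real A / r)) < m * (ε / 2) := by
    have : ‖S‖ * (2 * m * (m ^ 2 * μ.real A / r)) = m * (‖S‖ * (2 * m ^ 2 * μ.real A) / r) := by
      ring
    rw [this]
    refine mul_lt_mul_of_pos_left ?_ hm0
    rw [div_lt_iff₀ hr0]
    linarith
  have : m * ‖S h‖ < m * ε := by linarith
  exact lt_of_mul_lt_mul_left this hm0.le

/-- The target space varies in the induction because the step passes from `X` to `Fin N → X`. -/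
theorem isNarrow_of_mem_uncIter (hμ : IsNonatomic μ) (n : ℕ) :
    ∀ {X : Type*} [NormedAddCommGroup X] [NormedSpace ℝ X] (S : Lp ℝ 1 μ →L[ℝ] X),
      S ∈ uncIter (Lp ℝ 1 μ) X n → IsNarrow S := by
  induction n with
  | zero => exact fun S hS => hμ.isNarrow_of_isCompactOperator hS
  | succ n ih =>
    rintro X _ _ S ⟨T, hT, hS⟩
    exact hS.isNarrow hμ <| .of_isNarrow_pi fun N => ih _ (uncIter_pi n N _ fun i => hT i)

end NarrowSums

theorem corollary4 {Ω : Type*} [MeasurableSpace Ω] (μ : Measure Ω) [IsProbabilityMeasure μ]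
    (hμ : IsNonatomic μ)
    {X : Type*} [NormedAddCommGroup X] [NormedSpace ℝ X] [CompleteSpace X]
    (n : ℕ) (J : Lp ℝ 1 μ →L[ℝ] X) (hJ : IsIsomorphicEmbedding J) :
    J ∉ uncIter (Lp ℝ 1 μ) X n :=
  fun h => (isNarrow_of_mem_uncIter hμ n J h).not_isIsomorphicEmbedding hJ
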